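/- Let $L\ge 1$, let $u_0\in L^2(-L,L)$ be real-valued, and let $u$ be a global solution of the $2L$-periodic differentiated Kuramoto--Sivashinsky equation $$u_t+u_{xxxx}+u_{xx}+uu_x=0,\qquad u(t,x+2L)=u(t,x),\qquad u(0,\cdot)=u_0,$$ that is, $u\in C([0,\infty);L^2(-L,L))$, $u(0)=u_0$, and for all $t\ge 0$ and all smooth $2L$-periodic $\varphi:\mathbb R\to\mathbb R$, $$\int_{-L}^{L}u(t)\varphi\,dx=\int_{-L}^{L}u_0\varphi\,dx+\int_0^t\!\int_{-L}^{L}\Big(-u\,\varphi''''-u\,\varphi''+\tfrac12u^2\varphi'\Big)dx\,ds .$$ Suppose that $H=\sup_{0\le s<\infty}\|u(s)\|_{L^2(-L,L)}$ is finite (if it is infinite the estimate below is void). For $N\geq 0$ let $P_{>N}f$ denote the part of the Fourier series $f=\sum_{k\in\mathbb Z}c_ke^{i\pi kx/L}$ of $f\in L^2(-L,L)$ with $|k|>N$, i.e. $P_{>N}f=f-\sum_{|k|\le N}c_ke^{i\pi kx/L}$. Then there are absolute constants $C_0,C_1>0$ (independent of $L$, $u_0$, $u$, $H$, $j$, $t$)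 such that for every integer $j\ge 0$ and every $t\ge 0$, $$\big\|P_{>C_0\,2^j\max(1,H)^{2/5}L}\,u(t)\big\|_{L^2(-L,L)}\le C_1^{\,j}\;2^{-\frac12\min(t,5/2)\,j^2}\,H .$$ In particular, when $H\ge 1$ the cutoff is $C_0\,2^jH^{2/5}L$. -/

import Mathlib

open MeasureTheory Set
open scoped ContDiff

noncomputable section

namespace KuramotoSivashinsky

/-- Lebesgue measure on one period `(-L, L]`. -/
abbrev periodMeasure (L : ℝ) : Measure ℝ := volume.restrict (Ioc (-L) L)

/-- The space `L²(-L, L)` of real-valued square integrable functions on one period. -/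
abbrev L2 (L : ℝ) : Type := Lp ℝ 2 (periodMeasure L)

/-- `u` is a global solution with initial value `u₀ ∈ L²(-L, L)` of the `2L`-periodic equation
`u_t + u_xxxx + u_xx + u u_x = 0`: it is continuous in time with values in `L²(-L, L)`, and it
satisfies the equation, with `u u_x = (u² / 2)_x`, weakly against all smooth `2L`-periodic test
functions, integrated in time. The periodic boundary condition is carried by the test functions. -/
structure IsSolution (L : ℝ) (u₀ : L2 L) (u : ℝ → L2 L) : Prop where
  continuousOn : ContinuousOn u (Ici 0)
  initial : u 0 = u₀
  weak_form : ∀ φ : ℝ → ℝ, ContDiff ℝ ∞ φ → Function.Periodic φ (2 * L) → ∀ t : ℝ, 0 ≤ t →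
    ∫ x, u t x * φ x ∂periodMeasure L =
      (∫ x, u₀ x * φ x ∂periodMeasure L) +
        ∫ s in (0 : ℝ)..t, ∫ x, (-(u s x * iteratedDeriv 4 φ x) - u s x * iteratedDeriv 2 φ x
          + 1 / 2 * (u s x) ^ 2 * deriv φ x) ∂periodMeasure L

/-- The Littlewood-Paley projection `P_{≤ N}`: the part `∑_{|k| ≤ N} c_k e^{iπkx/L}` of the Fourier
series of `f` on `[-L, L]`, where `c_k = (2L)⁻¹ ∫_{-L}^{L} f(x) e^{-iπkx/L} dx`. -/
def lowPass (L : ℝ) (hL : 0 < L) (N : ℝ) (f : ℝ → ℝ) (x : ℝ) : ℂ :=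
  ∑ k ∈ Finset.Icc (-⌊N⌋) ⌊N⌋,
    fourierCoeffOn (neg_lt_self hL) (fun y => (f y : ℂ)) k *
      Complex.exp (Complex.I * Real.pi * k * x / L)

/-- The complementary projection `P_{> N} = 1 - P_{≤ N}`, which keeps the frequencies
`|k| > N`. -/
def highPass (L : ℝ) (hL : 0 < L) (N : ℝ) (f : ℝ → ℝ) (x : ℝ) : ℂ :=
  (f x : ℂ) - lowPass L hL N f x

end KuramotoSivashinsky

end

/-! The proof is an induction on the dyadic scale `j`, giving `C₀ = 1` and `C₁ = 2`; `j = 0` is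
Bessel's inequality. Put `M = max 1 H ^ (2/5)` and `R = 2 ^ (j+1) * M`. With `ξ = πk/L`, the `k`-th
Fourier coefficient decays at rate `ξ⁴ - ξ²` and is forced by `ξ/2` times that of `u²`. If `|k| > R
* L`, two frequencies of size at most `R * L / 2` cannot sum to `k`, so the forcing is controlled by
`H` times the norm of the part of `u` beyond `R * L / 2 = 2 ^ j * M * L`, which the induction
hypothesis bounds (`norm_integral_sq_mul_mode_le`).

Duhamel's formula (`abs_le_of_eq_integral`) then gains `|ξ| / ξ⁴`, and summing `|ξ|⁻⁶` over `|k| > R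
* L` gives the factor `H² / R⁵ ≤ 2 ^ (-5(j+1))` for the squared norm
(`IsSolution.integral_highPass_sq_le`). Passing from `j²` to `(j+1)²` in the exponent costs `2 ^
(τ(2j+1))` with `τ = min t (5/2)`; the gain pays for it because `τ ≤ 5/2`. -/

noncomputable section

namespace KuramotoSivashinsky

/-! ### Fourier modes on one period. -/

/-- The Fourier mode `e^{iπkx/L}`. -/
def mode (L : ℝ) (k : ℤ) (x : ℝ) : ℂ := Complex.exp (Complex.I * Real.pi * k * x / L)

theorem mode_eq_exp_ofReal (L : ℝ) (k : ℤ) (x : ℝ) :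
    mode L k x = Complex.exp ((Real.pi * k * x / L : ℝ) * Complex.I) := by
  unfold mode; congr 1; push_cast; ring

@[simp] theorem norm_mode (L : ℝ) (k : ℤ) (x : ℝ) : ‖mode L k x‖ = 1 := by
  rw [mode_eq_exp_ofReal, Complex.norm_exp_ofReal_mul_I]

theorem mode_mul_mode (L : ℝ) (k m : ℤ) (x : ℝ) :
    mode L k x * mode L m x = mode L (k + m) x := by
  unfold mode; rw [← Complex.exp_add]; congr 1; push_cast; ring

theorem continuous_mode (L : ℝ) (k : ℤ) : Continuous (mode L k) := by
  unfold mode; fun_prop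

theorem memLp_mode (L : ℝ) (k : ℤ) (p : ENNReal) : MemLp (mode L k) p (periodMeasure L) :=
  MemLp.of_bound (continuous_mode L k).aestronglyMeasurable 1 (by simp)

theorem integral_mode {L : ℝ} (hL : 0 < L) (k : ℤ) :
    ∫ x, mode L k x ∂periodMeasure L = if k = 0 then ((2 * L : ℝ) : ℂ) else 0 := by
  have hLc : (L : ℂ) ≠ 0 := by exact_mod_cast hL.ne'
  rw [← intervalIntegral.integral_of_le (neg_lt_self hL).le]
  split_ifs with hk
  · subst hk
    simp [mode]; ring
  · have hc : Complex.I * Real.pi * k / L ≠ 0 := by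
      have : (k : ℂ) ≠ 0 := by exact_mod_cast hk
      have : (Real.pi : ℂ) ≠ 0 := by exact_mod_cast Real.pi_ne_zero
      simp [*]
    have h := integral_exp_mul_complex (a := -L) (b := L) hc
    have h2 : ∀ x : ℝ, mode L k x = Complex.exp (Complex.I * Real.pi * k / L * x) := by
      intro x; unfold mode; congr 1; ring
    simp_rw [h2]
    rw [h, div_eq_zero_iff]
    left
    rw [sub_eq_zero, Complex.exp_eq_exp_iff_exists_int]
    refine ⟨k, ?_⟩
    push_cast
    field_simp
    ring

theorem fourierCoeffOn_eq_integral_mode {L : ℝ} (hL : 0 < L) (f : ℝ → ℂ) (k : ℤ) :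
    fourierCoeffOn (neg_lt_self hL) f k =
      ((2 * L : ℝ) : ℂ)⁻¹ * ∫ x, f x * mode L (-k) x ∂periodMeasure L := by
  rw [fourierCoeffOn_eq_integral, intervalIntegral.integral_of_le (neg_lt_self hL).le,
    Complex.real_smul]
  have hLc : (L : ℂ) ≠ 0 := by exact_mod_cast hL.ne'
  congr 1
  · push_cast; rw [one_div]; congr 1; ring
  · refine integral_congr_ae (Filter.Eventually.of_forall fun x => ?_)
    simp only [fourier_coe_apply, smul_eq_mul]
    rw [mul_comm]
    congr 1
    unfold mode
    congr 1
    push_cast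
    field_simp
    ring

/-! ### Cauchy–Schwarz and `L²` norms as integrals. -/

theorem norm_integral_mul_sq_le {α : Type*} [MeasurableSpace α] {μ : Measure α} {f g : α → ℂ}
    (hf : MemLp f 2 μ) (hg : MemLp g 2 μ) :
    ‖∫ x, f x * g x ∂μ‖ ^ 2 ≤ (∫ x, ‖f x‖ ^ 2 ∂μ) * ∫ x, ‖g x‖ ^ 2 ∂μ := by
  have h1 : ‖∫ x, f x * g x ∂μ‖ ≤ ∫ x, ‖f x‖ * ‖g x‖ ∂μ := by
    refine (norm_integral_le_integral_norm _).trans_eq ?_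
    simp
  have h2 := integral_mul_norm_le_Lp_mul_Lq (μ := μ) (f := f) (g := g)
    Real.HolderConjugate.two_two (by simpa using hf) (by simpa using hg)
  simp only [Real.rpow_two] at h2
  rw [← Real.mul_rpow (by positivity) (by positivity), ← Real.sqrt_eq_rpow] at h2
  calc _ ≤ (√((∫ x, ‖f x‖ ^ 2 ∂μ) * ∫ x, ‖g x‖ ^ 2 ∂μ)) ^ 2 := by
        gcongr; exact h1.trans h2
    _ = _ := Real.sq_sqrt (by positivity)

theorem eLpNorm_two_eq_ofReal_sqrt {α : Type*} [MeasurableSpace α] {μ : Measure α} {f : α → ℂ}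
    (hf : MemLp f 2 μ) :
    eLpNorm f 2 μ = ENNReal.ofReal √(∫ x, ‖f x‖ ^ 2 ∂μ) := by
  rw [hf.eLpNorm_eq_integral_rpow_norm (by simp) (by simp), Real.sqrt_eq_rpow]
  simp

theorem memLp_ofReal {L : ℝ} (f : L2 L) :
    MemLp (fun x => ((f x : ℝ) : ℂ)) 2 (periodMeasure L) := (Lp.memLp f).ofReal

theorem integral_norm_ofReal_sq {L : ℝ} (f : L2 L) :
    ∫ x, ‖((f x : ℝ) : ℂ)‖ ^ 2 ∂periodMeasure L = ‖f‖ ^ 2 := by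
  have h := eLpNorm_two_eq_ofReal_sqrt (memLp_ofReal f)
  have h2 : eLpNorm (fun x => ((f x : ℝ) : ℂ)) 2 (periodMeasure L)
      = eLpNorm f 2 (periodMeasure L) := eLpNorm_congr_norm_ae (by simp)
  rw [Lp.norm_def, ← h2, h, ENNReal.toReal_ofReal (by positivity), Real.sq_sqrt]
  positivity

/-! ### Frequency projections and Parseval. -/

variable {L : ℝ} (hL : 0 < L)

theorem lowPass_eq_sum (N : ℝ) (f : ℝ → ℝ) :
    lowPass L hL N f = ∑ k ∈ Finset.Icc (-⌊N⌋) ⌊N⌋,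
      fun x => fourierCoeffOn (neg_lt_self hL) (fun y => (f y : ℂ)) k * mode L k x := by
  ext x; simp [lowPass, mode]

theorem memLp_lowPass (N : ℝ) (f : ℝ → ℝ) (p : ENNReal) :
    MemLp (lowPass L hL N f) p (periodMeasure L) := by
  rw [lowPass_eq_sum]
  exact memLp_finsetSum' _ fun k _ => (memLp_mode L k p).const_mul _

theorem memLp_highPass (N : ℝ) (f : L2 L) :
    MemLp (highPass L hL N f) 2 (periodMeasure L) :=
  (memLp_ofReal f).sub (memLp_lowPass hL N f 2)

theorem integral_sum_mode_mul_mode {L : ℝ} (hL : 0 < L) (s : Finset ℤ) (c : ℤ → ℂ) (m : ℤ) :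
    ∫ x, (∑ k ∈ s, c k * mode L k x) * mode L (-m) x ∂periodMeasure L =
      if m ∈ s then c m * (2 * L : ℝ) else 0 := by
  simp_rw [Finset.sum_mul, mul_assoc, mode_mul_mode]
  rw [integral_finsetSum _ fun k _ =>
    ((memLp_mode L (k + -m) 1).const_mul _).integrable le_rfl]
  simp_rw [integral_const_mul, integral_mode hL, ← sub_eq_add_neg, sub_eq_zero, mul_ite, mul_zero]
  simp

theorem fourierCoeffOn_lowPass (N : ℝ) (f : ℝ → ℝ) (m : ℤ) :
    fourierCoeffOn (neg_lt_self hL) (lowPass L hL N f) m =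
      if m ∈ Finset.Icc (-⌊N⌋) ⌊N⌋ then
        fourierCoeffOn (neg_lt_self hL) (fun y => (f y : ℂ)) m else 0 := by
  have hLc : (L : ℂ) ≠ 0 := by exact_mod_cast hL.ne'
  rw [fourierCoeffOn_eq_integral_mode hL]
  have := integral_sum_mode_mul_mode hL (Finset.Icc (-⌊N⌋) ⌊N⌋)
    (fourierCoeffOn (neg_lt_self hL) (fun y => (f y : ℂ))) m
  have h2 : ∀ x, lowPass L hL N f x = ∑ k ∈ Finset.Icc (-⌊N⌋) ⌊N⌋,
      fourierCoeffOn (neg_lt_self hL) (fun y => (f y : ℂ)) k * mode L k x := fun x => rfl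
  simp_rw [h2]
  rw [this]
  split_ifs
  · push_cast; field_simp
  · simp

theorem fourierCoeffOn_sub {f g : ℝ → ℂ} (hf : MemLp f 2 (periodMeasure L))
    (hg : MemLp g 2 (periodMeasure L)) (m : ℤ) :
    fourierCoeffOn (neg_lt_self hL) (fun x => f x - g x) m =
      fourierCoeffOn (neg_lt_self hL) f m - fourierCoeffOn (neg_lt_self hL) g m := by
  simp_rw [fourierCoeffOn_eq_integral_mode hL, sub_mul]
  rw [integral_sub, mul_sub]
  · exact hf.integrable_mul (memLp_mode L _ 2)
  · exact hg.integrable_mul (memLp_mode L _ 2)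

theorem hasSum_sq_coeff {f : ℝ → ℂ} (hf : MemLp f 2 (periodMeasure L)) :
    HasSum (fun k => ‖fourierCoeffOn (neg_lt_self hL) f k‖ ^ 2)
      ((2 * L)⁻¹ * ∫ x, ‖f x‖ ^ 2 ∂periodMeasure L) := by
  have := hasSum_sq_fourierCoeffOn (neg_lt_self hL) hf
  rwa [intervalIntegral.integral_of_le (neg_lt_self hL).le, smul_eq_mul,
    show L - -L = 2 * L by ring] at this

theorem fourierCoeffOn_highPass (N : ℝ) (f : L2 L) (m : ℤ) :
    fourierCoeffOn (neg_lt_self hL) (highPass L hL N f) m =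
      if m ∈ Finset.Icc (-⌊N⌋) ⌊N⌋ then 0 else
        fourierCoeffOn (neg_lt_self hL) (fun y => (f y : ℂ)) m := by
  have : highPass L hL N f = fun x => (f x : ℂ) - lowPass L hL N f x := rfl
  rw [this, fourierCoeffOn_sub hL (memLp_ofReal f) (memLp_lowPass hL N f 2),
    fourierCoeffOn_lowPass]
  split_ifs <;> simp

theorem hasSum_highPass (N : ℝ) (f : L2 L) :
    HasSum (fun k => if k ∈ Finset.Icc (-⌊N⌋) ⌊N⌋ then 0 else
        ‖fourierCoeffOn (neg_lt_self hL) (fun y => (f y : ℂ)) k‖ ^ 2)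
      ((2 * L)⁻¹ * ∫ x, ‖highPass L hL N f x‖ ^ 2 ∂periodMeasure L) := by
  refine (hasSum_sq_coeff hL (memLp_highPass hL N f)).congr_fun ?_
  intro k
  rw [fourierCoeffOn_highPass]
  split_ifs <;> simp

theorem hasSum_coeff (f : L2 L) :
    HasSum (fun k => ‖fourierCoeffOn (neg_lt_self hL) (fun y => (f y : ℂ)) k‖ ^ 2)
      ((2 * L)⁻¹ * ‖f‖ ^ 2) := by
  rw [← integral_norm_ofReal_sq]
  exact hasSum_sq_coeff hL (memLp_ofReal f)

theorem integral_norm_highPass_sq_le (N : ℝ) (f : L2 L) :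
    ∫ x, ‖highPass L hL N f x‖ ^ 2 ∂periodMeasure L ≤ ‖f‖ ^ 2 := by
  refine le_of_mul_le_mul_left (a := (2 * L)⁻¹) ?_ (by positivity)
  refine hasSum_le (fun k => ?_) (hasSum_highPass hL N f) (hasSum_coeff hL f)
  split_ifs
  · positivity
  · rfl

theorem integral_norm_lowPass_sq_le (N : ℝ) (f : L2 L) :
    ∫ x, ‖lowPass L hL N f x‖ ^ 2 ∂periodMeasure L ≤ ‖f‖ ^ 2 := by
  refine le_of_mul_le_mul_left (a := (2 * L)⁻¹) ?_ (by positivity)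
  refine hasSum_le (fun k => ?_) (hasSum_sq_coeff hL (memLp_lowPass hL N f 2)) (hasSum_coeff hL f)
  rw [fourierCoeffOn_lowPass]
  split_ifs
  · rfl
  · simp

/-! ### The quadratic term at high frequency. -/

theorem integral_lowPass_sq_mul_mode_eq_zero {N : ℝ} {k : ℤ} (hk : 2 * N < |(k : ℝ)|)
    (f : ℝ → ℝ) :
    ∫ x, lowPass L hL N f x ^ 2 * mode L (-k) x ∂periodMeasure L = 0 := by
  set c := fourierCoeffOn (neg_lt_self hL) (fun y => (f y : ℂ))
  set s := Finset.Icc (-⌊N⌋) ⌊N⌋ with hs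
  have h2 : ∀ x, lowPass L hL N f x ^ 2 * mode L (-k) x =
      ∑ p ∈ s, ∑ q ∈ s, c p * c q * mode L (p + q + -k) x := by
    intro x
    have : lowPass L hL N f x = ∑ p ∈ s, c p * mode L p x := rfl
    rw [this, sq, Finset.sum_mul_sum, Finset.sum_mul]
    refine Finset.sum_congr rfl fun p _ => ?_
    rw [Finset.sum_mul]
    refine Finset.sum_congr rfl fun q _ => ?_
    rw [← mode_mul_mode, ← mode_mul_mode]; ring
  have hi : ∀ p q, Integrable (fun x => c p * c q * mode L (p + q + -k) x) (periodMeasure L) :=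
    fun p q => ((memLp_mode L _ 1).const_mul _).integrable le_rfl
  simp_rw [h2]
  rw [integral_finsetSum _ fun p _ => integrable_finsetSum _ fun q _ => hi p q]
  refine Finset.sum_eq_zero fun p hp => ?_
  rw [integral_finsetSum _ fun q _ => hi p q]
  refine Finset.sum_eq_zero fun q hq => ?_
  rw [integral_const_mul, integral_mode hL, if_neg, mul_zero]
  intro h
  have hpq : k = p + q := by omega
  rw [hs, Finset.mem_Icc] at hp hq
  have h3 : |k| ≤ 2 * ⌊N⌋ := by rw [abs_le]; omega
  have h4 : (|k| : ℝ) ≤ 2 * ⌊N⌋ := by exact_mod_cast h3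
  have := Int.floor_le N
  linarith

/-- Write `f² = low² + high * (f + low)`. The first term has no frequency `k`; Cauchy–Schwarz bounds
each of the other two, since both `f` and `low` have norm at most `‖f‖`. -/
theorem norm_integral_sq_mul_mode_le {N : ℝ} {k : ℤ} (hk : 2 * N < |(k : ℝ)|) (f : L2 L) :
    ‖∫ x, ((f x : ℝ) : ℂ) ^ 2 * mode L (-k) x ∂periodMeasure L‖ ≤
      2 * ‖f‖ * √(∫ x, ‖highPass L hL N f x‖ ^ 2 ∂periodMeasure L) := by
  set W := √(∫ x, ‖highPass L hL N f x‖ ^ 2 ∂periodMeasure L) with hW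
  have hmul : ∀ {g : ℝ → ℂ}, MemLp g 2 (periodMeasure L) →
      MemLp (fun x => g x * mode L (-k) x) 2 (periodMeasure L) := fun {g} hg =>
    hg.of_le (hg.1.mul (continuous_mode L _).aestronglyMeasurable) (by simp)
  have key : ∀ {g : ℝ → ℂ}, MemLp g 2 (periodMeasure L) →
      ∫ x, ‖g x‖ ^ 2 ∂periodMeasure L ≤ ‖f‖ ^ 2 →
      ‖∫ x, highPass L hL N f x * (g x * mode L (-k) x) ∂periodMeasure L‖ ≤ ‖f‖ * W := by
    intro g hg hgf
    refine abs_le_of_sq_le_sq' ?_ (by positivity) |>.2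
    refine (norm_integral_mul_sq_le (memLp_highPass hL N f) (hmul hg)).trans ?_
    rw [mul_pow, hW, Real.sq_sqrt (by positivity), mul_comm]
    simp only [norm_mul, norm_mode, mul_one]
    gcongr
  have e1 := key (memLp_ofReal f) (integral_norm_ofReal_sq f).le
  have e2 := key (memLp_lowPass hL N f 2) (integral_norm_lowPass_sq_le hL N f)
  have hsplit : ∀ x, ((f x : ℝ) : ℂ) ^ 2 * mode L (-k) x =
      lowPass L hL N f x ^ 2 * mode L (-k) x +
      (highPass L hL N f x * (((f x : ℝ) : ℂ) * mode L (-k) x) +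
      highPass L hL N f x * (lowPass L hL N f x * mode L (-k) x)) := by
    intro x; unfold highPass; ring
  have i0 : Integrable (fun x => lowPass L hL N f x ^ 2 * mode L (-k) x) (periodMeasure L) := by
    simp_rw [sq, mul_assoc]
    exact (memLp_lowPass hL N f 2).integrable_mul (hmul (memLp_lowPass hL N f 2))
  have i1 := (memLp_highPass hL N f).integrable_mul (hmul (memLp_ofReal f))
  have i2 := (memLp_highPass hL N f).integrable_mul (hmul (memLp_lowPass hL N f 2))
  simp_rw [hsplit]
  have hsum := integral_add i0 (i1.add i2)
  have hsum' := integral_add i1 i2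
  simp only [Pi.add_apply, Pi.mul_apply] at hsum hsum'
  rw [hsum, hsum', integral_lowPass_sq_mul_mode_eq_zero hL hk, zero_add]
  refine (norm_add_le _ _).trans ?_
  linarith

/-! ### Duhamel's formula as an inequality. -/

/-- A Duhamel estimate for `f' = -λ f + g` in integrated form. -/
theorem abs_le_of_eq_integral {f g : ℝ → ℝ} {lam β B T : ℝ} (hT : 0 ≤ T) (hβ : β < lam)
    (hf : ContinuousOn f (Ici 0)) (hg : ContinuousOn g (Ici 0))
    (heq : ∀ t, 0 ≤ t → f t = f 0 + ∫ s in (0 : ℝ)..t, (-(lam * f s) + g s))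
    (hB : ∀ s ∈ Icc 0 T, |g s| ≤ B * Real.exp (β * (T - s))) :
    |f T| ≤ Real.exp (-(lam * T)) * |f 0| + B / (lam - β) := by
  have hB0 : 0 ≤ B := by simpa using (abs_nonneg _).trans (hB T ⟨hT, le_rfl⟩)
  have hd : 0 < lam - β := sub_pos.2 hβ
  -- Freezing the integrand for negative times makes it continuous on all of `ℝ`, so the fundamental
  -- theorem of calculus also applies at `0`.
  set q : ℝ → ℝ := fun s => -(lam * f (max s 0)) + g (max s 0) with hq
  have hmax : ∀ {h : ℝ → ℝ}, ContinuousOn h (Ici 0) → Continuous fun s => h (max s 0) :=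
    fun hh => hh.comp_continuous (by fun_prop) fun s => mem_Ici.2 (le_max_right _ _)
  have hqc : Continuous q := ((hmax hf).const_mul lam).neg.add (hmax hg)
  have hfq : ∀ t, 0 ≤ t → f t = f 0 + ∫ s in (0 : ℝ)..t, q s := by
    intro t ht
    rw [heq t ht]
    congr 1
    refine intervalIntegral.integral_congr fun s hs => ?_
    rw [uIcc_of_le ht] at hs
    simp [hq, max_eq_left hs.1]
  have hder : ∀ x, 0 ≤ x → HasDerivWithinAt f (-(lam * f x) + g x) (Ici x) x := by
    intro x hx
    have h1 := ((hqc.integral_hasStrictDerivAt 0 x).hasDerivAt.const_add (f 0)).hasDerivWithinAt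
      (s := Ici x)
    have h2 : q x = -(lam * f x) + g x := by simp [hq, max_eq_left hx]
    rw [← h2]
    exact h1.congr (fun y hy => hfq y (hx.trans hy)) (hfq x hx)
  have hexp : ∀ c x : ℝ, HasDerivAt (fun y => Real.exp (c * y)) (Real.exp (c * x) * c) x :=
    fun c x => by simpa using ((hasDerivAt_id x).const_mul c).exp
  -- Integrating factor: `e^{λt} f` has right derivative `e^{λt} g`, which is compared with the
  -- explicit antiderivative of its upper bound.
  have main := image_norm_le_of_norm_deriv_right_le_deriv_boundary' (a := 0) (b := T)
    (f := fun t => Real.exp (lam * t) * f t) (f' := fun t => Real.exp (lam * t) * g t)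
    (B := fun t => |f 0| + B * Real.exp (β * T) / (lam - β) * (Real.exp ((lam - β) * t) - 1))
    (B' := fun t => B * Real.exp (β * T) / (lam - β) * (Real.exp ((lam - β) * t) * (lam - β)))
    (((by fun_prop : Continuous fun t => Real.exp (lam * t)).continuousOn).mul
      (hf.mono Icc_subset_Ici_self))
    (fun x hx => by
      convert! (hexp lam x).hasDerivWithinAt.mul (hder x hx.1) using 1
      ring)
    (by simp) (by fun_prop)
    (fun x _ => ((((hexp (lam - β) x).sub_const 1).const_mul _).const_add _).hasDerivWithinAt)
    (fun x hx => by
      rw [Real.norm_eq_abs, abs_mul, Real.abs_exp]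
      refine (mul_le_mul_of_nonneg_left (hB x ⟨hx.1, hx.2.le⟩) (Real.exp_pos _).le).trans_eq ?_
      have e1 : Real.exp (lam * x) * Real.exp (β * (T - x)) =
          Real.exp (β * T) * Real.exp ((lam - β) * x) := by
        rw [← Real.exp_add, ← Real.exp_add]; congr 1; ring
      have e4 : B * Real.exp (β * T) / (lam - β) * (lam - β) = B * Real.exp (β * T) :=
        div_mul_cancel₀ _ hd.ne'
      linear_combination B * e1 - Real.exp ((lam - β) * x) * e4)
    (right_mem_Icc.2 hT)
  simp only [Real.norm_eq_abs, abs_mul, Real.abs_exp] at main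
  have e2 : |f T| = Real.exp (-(lam * T)) * (Real.exp (lam * T) * |f T|) := by
    rw [← mul_assoc, ← Real.exp_add]; simp
  have e3 : Real.exp (-(lam * T)) * (Real.exp (β * T) * Real.exp ((lam - β) * T)) = 1 := by
    rw [← Real.exp_add, ← Real.exp_add, ← Real.exp_zero]; congr 1; ring
  rw [e2]
  calc _ ≤ Real.exp (-(lam * T)) * (|f 0| +
        B * Real.exp (β * T) / (lam - β) * Real.exp ((lam - β) * T)) := by
        gcongr
        refine main.trans ?_
        gcongr
        linarith
    _ = Real.exp (-(lam * T)) * |f 0| + B / (lam - β) *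
        (Real.exp (-(lam * T)) * (Real.exp (β * T) * Real.exp ((lam - β) * T))) := by ring
    _ = _ := by rw [e3, mul_one]

/-! ### Continuity of the linear and quadratic pairings on `L²`. -/

theorem continuous_integral_mul {L : ℝ} {φ : ℝ → ℝ} (hφ : MemLp φ 2 (periodMeasure L)) :
    Continuous fun f : L2 L => ∫ x, f x * φ x ∂periodMeasure L := by
  have h : ∀ f : L2 L, ∫ x, f x * φ x ∂periodMeasure L =
      (ContinuousLinearMap.mul ℝ ℝ).lpPairing (periodMeasure L) 2 2 f hφ.toLp := by
    intro f
    rw [ContinuousLinearMap.lpPairing_eq_integral]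
    refine integral_congr_ae ?_
    filter_upwards [hφ.coeFn_toLp] with x hx
    simp [hx]
  simp_rw [h]
  fun_prop

theorem continuous_integral_sq_mul {L : ℝ} {φ : ℝ → ℝ}
    (hφ : MemLp φ ⊤ (periodMeasure L)) :
    Continuous fun f : L2 L => ∫ x, f x ^ 2 * φ x ∂periodMeasure L := by
  have h : ∀ f : L2 L, ∫ x, f x ^ 2 * φ x ∂periodMeasure L =
      (ContinuousLinearMap.mul ℝ ℝ).lpPairing (periodMeasure L) 1 ⊤
        ((ContinuousLinearMap.mul ℝ ℝ).holderL (periodMeasure L) 2 2 1 f f) hφ.toLp := by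
    intro f
    rw [ContinuousLinearMap.lpPairing_eq_integral]
    refine integral_congr_ae ?_
    filter_upwards [hφ.coeFn_toLp, (ContinuousLinearMap.mul ℝ ℝ).coeFn_holder (r := 1) f f]
      with x hx hx2
    have h3 : ((ContinuousLinearMap.mul ℝ ℝ).holderL (periodMeasure L) 2 2 1 f f) x = f x * f x :=
      hx2
    simp only [ContinuousLinearMap.mul_apply', hx, h3]
    ring
  simp_rw [h]
  fun_prop

/-! ### The evolution of a single Fourier coefficient. -/

theorem re_exp_mul_integral_mode {L θ : ℝ} {k : ℤ} {f : ℝ → ℝ}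
    (hf : Integrable (fun x => (f x : ℂ) * mode L (-k) x) (periodMeasure L)) :
    (Complex.exp (-(θ * Complex.I)) * ∫ x, (f x : ℂ) * mode L (-k) x ∂periodMeasure L).re =
      ∫ x, f x * Real.cos (Real.pi * k / L * x + θ) ∂periodMeasure L := by
  rw [← integral_const_mul]
  refine (Complex.reCLM.integral_comp_comm (hf.const_mul _)).symm.trans ?_
  refine integral_congr_ae (Filter.Eventually.of_forall fun x => ?_)
  have : Complex.exp (-(θ * Complex.I)) * ((f x : ℂ) * mode L (-k) x) =
      f x * Complex.exp ((-(Real.pi * k / L * x + θ) : ℝ) * Complex.I) := by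
    rw [mode_eq_exp_ofReal, mul_left_comm, ← Complex.exp_add]
    congr 2; push_cast; ring
  simp only [Complex.reCLM_apply]
  rw [this, Complex.re_ofReal_mul, Complex.exp_ofReal_mul_I_re, Real.cos_neg]

theorem abs_integral_mul_cos_le {L θ : ℝ} {k : ℤ} {f : ℝ → ℝ}
    (hf : Integrable (fun x => (f x : ℂ) * mode L (-k) x) (periodMeasure L)) :
    |∫ x, f x * Real.cos (Real.pi * k / L * x + θ) ∂periodMeasure L| ≤
      ‖∫ x, (f x : ℂ) * mode L (-k) x ∂periodMeasure L‖ := by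
  rw [← re_exp_mul_integral_mode hf]
  refine (Complex.abs_re_le_norm _).trans_eq ?_
  rw [norm_mul, ← neg_mul, ← Complex.ofReal_neg, Complex.norm_exp_ofReal_mul_I, one_mul]

theorem integrable_mul_mode {L : ℝ} {f : ℝ → ℂ} (hf : Integrable f (periodMeasure L)) (k : ℤ) :
    Integrable (fun x => f x * mode L k x) (periodMeasure L) :=
  hf.mul_bdd (continuous_mode L k).aestronglyMeasurable (c := 1) (by simp)

/-- Test functions are real, so the complex coefficient is reached through a cosine with a suitable
phase; the weak form becomes a scalar equation to which `abs_le_of_eq_integral` applies. -/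
theorem IsSolution.norm_integral_mode_le {L : ℝ} (hL : 0 < L) {u₀ : L2 L} {u : ℝ → L2 L}
    (hu : IsSolution L u₀ u) {k : ℤ} {T β B lam : ℝ} (hT : 0 ≤ T)
    (hlam : lam = (Real.pi * k / L) ^ 4 - (Real.pi * k / L) ^ 2) (hβ : β < lam)
    (hB : ∀ s ∈ Icc 0 T, |Real.pi * k / L| / 2 *
      ‖∫ x, ((u s x : ℝ) : ℂ) ^ 2 * mode L (-k) x ∂periodMeasure L‖
        ≤ B * Real.exp (β * (T - s))) :
    ‖∫ x, ((u T x : ℝ) : ℂ) * mode L (-k) x ∂periodMeasure L‖ ≤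
      Real.exp (-(lam * T)) * ‖∫ x, ((u 0 x : ℝ) : ℂ) * mode L (-k) x ∂periodMeasure L‖ +
        B / (lam - β) := by
  set ξ := Real.pi * k / L with hξ
  -- The phase is that of the coefficient at the final time `T`, so that pairing with the cosine at
  -- time `T` gives exactly its modulus. At other times only an inequality is needed.
  set θ := Complex.arg (∫ x, ((u T x : ℝ) : ℂ) * mode L (-k) x ∂periodMeasure L) with hθ
  set φ : ℝ → ℝ := fun x => Real.cos (ξ * x + θ) with hφ
  have hi : ∀ s, Integrable (fun x => ((u s x : ℝ) : ℂ)) (periodMeasure L) := fun s =>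
    (memLp_ofReal (u s)).integrable one_le_two
  have hi2 : ∀ s, Integrable (fun x => ((u s x : ℝ) : ℂ) ^ 2) (periodMeasure L) := fun s => by
    simp_rw [sq]; exact (memLp_ofReal (u s)).integrable_mul (memLp_ofReal (u s))
  have d1 : ∀ c : ℝ, deriv (fun x => c * Real.cos (ξ * x + θ)) =
      fun x => -(c * ξ) * Real.sin (ξ * x + θ) := by
    intro c; ext x
    have : HasDerivAt (fun x => c * Real.cos (ξ * x + θ)) (c * (-Real.sin (ξ * x + θ) * ξ)) x := by
      have h0 : HasDerivAt (fun x => ξ * x + θ) ξ x := by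
        simpa using ((hasDerivAt_id x).const_mul ξ).add_const θ
      exact h0.cos.const_mul c
    rw [this.deriv]; ring
  have d2 : ∀ c : ℝ, deriv (fun x => c * Real.sin (ξ * x + θ)) =
      fun x => c * ξ * Real.cos (ξ * x + θ) := by
    intro c; ext x
    have : HasDerivAt (fun x => c * Real.sin (ξ * x + θ)) (c * (Real.cos (ξ * x + θ) * ξ)) x := by
      have h0 : HasDerivAt (fun x => ξ * x + θ) ξ x := by
        simpa using ((hasDerivAt_id x).const_mul ξ).add_const θ
      exact h0.sin.const_mul c
    rw [this.deriv]; ring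
  have hφ1 : φ = fun x => 1 * Real.cos (ξ * x + θ) := by simp [hφ]
  have D1 : deriv φ = fun x => -ξ * Real.sin (ξ * x + θ) := by rw [hφ1, d1]; simp
  have D2 : iteratedDeriv 2 φ = fun x => -ξ ^ 2 * Real.cos (ξ * x + θ) := by
    rw [iteratedDeriv_succ, iteratedDeriv_one, D1, d2]; ext x; ring
  have D4 : iteratedDeriv 4 φ = fun x => ξ ^ 4 * Real.cos (ξ * x + θ) := by
    rw [iteratedDeriv_succ, iteratedDeriv_succ, D2, d1, d2]; ext x; ring
  have hsmooth : ContDiff ℝ ∞ φ := by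
    rw [hφ]; exact Real.contDiff_cos.comp (by fun_prop)
  have hper : Function.Periodic φ (2 * L) := by
    intro x
    have : ξ * (x + 2 * L) + θ = (ξ * x + θ) + k * (2 * Real.pi) := by
      rw [hξ]; field_simp; ring
    simp only [hφ]
    rw [this, Real.cos_add_int_mul_two_pi]
  have hsin : ∀ x, Real.sin (ξ * x + θ) = Real.cos (ξ * x + (θ - Real.pi / 2)) := by
    intro x; rw [← add_sub_assoc, Real.cos_sub_pi_div_two]
  have hcosLp : ∀ (p : ENNReal) (η : ℝ),
      MemLp (fun x => Real.cos (ξ * x + η)) p (periodMeasure L) := fun p η =>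
    MemLp.of_bound (by fun_prop) 1
      (Filter.Eventually.of_forall fun x => Real.abs_cos_le_one _)
  have hR : ∀ s, ∫ x, (-(u s x * iteratedDeriv 4 φ x) - u s x * iteratedDeriv 2 φ x
      + 1 / 2 * (u s x) ^ 2 * deriv φ x) ∂periodMeasure L =
      -(lam * ∫ x, u s x * φ x ∂periodMeasure L) +
      -(ξ / 2) * ∫ x, u s x ^ 2 * Real.cos (ξ * x + (θ - Real.pi / 2)) ∂periodMeasure L := by
    intro s
    rw [← integral_const_mul, ← integral_const_mul, ← integral_neg, ← integral_add]
    · refine integral_congr_ae (Filter.Eventually.of_forall fun x => ?_)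
      simp only [D1, D2, D4, hlam, ← hsin]
      simp only [hφ]
      ring
    · exact (((Lp.memLp (u s)).integrable_mul (hcosLp 2 θ)).const_mul _).neg
    · exact ((Lp.memLp (u s)).integrable_sq.mul_bdd (c := 1) (hcosLp 2 _).1
        (Filter.Eventually.of_forall fun x => Real.abs_cos_le_one _)).const_mul _
  have hweak := hu.weak_form φ hsmooth hper
  have main := abs_le_of_eq_integral (f := fun s => ∫ x, u s x * φ x ∂periodMeasure L)
    (g := fun s => -(ξ / 2) *
      ∫ x, u s x ^ 2 * Real.cos (ξ * x + (θ - Real.pi / 2)) ∂periodMeasure L)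
    (lam := lam) (β := β) (B := B) hT hβ
    ((continuous_integral_mul (hcosLp 2 θ)).comp_continuousOn hu.continuousOn)
    (((continuous_integral_sq_mul (hcosLp ⊤ _)).comp_continuousOn hu.continuousOn).const_mul _)
    (fun t ht => by
      rw [hweak t ht, hu.initial]
      simp_rw [hR])
    (fun s hs => by
      refine le_trans ?_ (hB s hs)
      rw [abs_mul, abs_neg, abs_div, abs_two]
      gcongr
      have := abs_integral_mul_cos_le (θ := θ - Real.pi / 2) (k := k) (f := fun x => u s x ^ 2)
        (L := L) (by simpa using integrable_mul_mode (hi2 s) (-k))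
      simpa using this)
  have hTeq : ∫ x, u T x * φ x ∂periodMeasure L =
      ‖∫ x, ((u T x : ℝ) : ℂ) * mode L (-k) x ∂periodMeasure L‖ := by
    rw [hφ, hξ, ← re_exp_mul_integral_mode (integrable_mul_mode (hi T) (-k))]
    have := Complex.norm_mul_exp_arg_mul_I
      (∫ x, ((u T x : ℝ) : ℂ) * mode L (-k) x ∂periodMeasure L)
    rw [← hθ] at this
    nth_rewrite 1 [← this]
    rw [mul_left_comm, ← Complex.exp_add]
    simp
  have h0 := abs_integral_mul_cos_le (θ := θ) (integrable_mul_mode (hi 0) (-k))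
  beta_reduce at main
  rw [hTeq, abs_norm] at main
  refine main.trans ?_
  gcongr

/-! ### Summing over high frequencies. -/

theorem not_mem_Icc_floor_iff {N : ℝ} {k : ℤ} :
    k ∉ Finset.Icc (-⌊N⌋) ⌊N⌋ ↔ N < |(k : ℝ)| := by
  rw [Finset.mem_Icc, ← abs_le, Int.le_floor, not_le, Int.cast_abs]

/-- Each absolute value is taken by at most two integers, which reduces the sum to a tail over the
naturals. -/
theorem sum_inv_sq_le {N : ℝ} (hN : 0 < N) (s : Finset ℤ) (hs : ∀ k ∈ s, N < |(k : ℝ)|) :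
    ∑ k ∈ s, ((k : ℝ) ^ 2)⁻¹ ≤ 4 / N := by
  have h1 : ∀ k : ℤ, ((k : ℝ) ^ 2)⁻¹ = ((k.natAbs : ℝ) ^ 2)⁻¹ := by
    intro k; rw [Nat.cast_natAbs, Int.cast_abs, sq_abs]
  have h2 : ∀ m : ℕ, (s.filter fun k => k.natAbs = m).card ≤ 2 := by
    intro m
    refine (Finset.card_le_card (t := {(m : ℤ), -(m : ℤ)}) fun k hk => ?_).trans
      Finset.card_le_two
    have := (Finset.mem_filter.1 hk).2
    simp only [Finset.mem_insert, Finset.mem_singleton]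
    omega
  obtain ⟨n, hn⟩ := (s.image Int.natAbs).exists_nat_subset_range
  have h3 : s.image Int.natAbs ⊆ Finset.Ioo ⌊N⌋₊ n := by
    intro m hm
    rw [Finset.mem_Ioo]
    refine ⟨?_, Finset.mem_range.1 (hn hm)⟩
    obtain ⟨k, hk, rfl⟩ := Finset.mem_image.1 hm
    rw [Nat.floor_lt hN.le, Nat.cast_natAbs, Int.cast_abs]
    exact hs k hk
  simp_rw [h1]
  rw [Finset.sum_comp (fun m : ℕ => ((m : ℝ) ^ 2)⁻¹) Int.natAbs]
  calc _ ≤ ∑ m ∈ s.image Int.natAbs, 2 * ((m : ℝ) ^ 2)⁻¹ := by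
        refine Finset.sum_le_sum fun m _ => ?_
        rw [nsmul_eq_mul]
        gcongr
        exact_mod_cast h2 m
    _ ≤ ∑ m ∈ Finset.Ioo ⌊N⌋₊ n, 2 * ((m : ℝ) ^ 2)⁻¹ :=
        Finset.sum_le_sum_of_subset_of_nonneg h3 fun _ _ _ => by positivity
    _ ≤ 2 * (2 / (⌊N⌋₊ + 1)) := by
        rw [← Finset.mul_sum]
        gcongr
        exact sum_Ioo_inv_sq_le _ _
    _ ≤ 2 * (2 / N) := by
        gcongr
        exact (Nat.lt_floor_add_one N).le
    _ = 4 / N := by ring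

theorem IsSolution.sq_norm_integral_mode_le {L : ℝ} (hL : 0 < L) {u₀ : L2 L} {u : ℝ → L2 L}
    (hu : IsSolution L u₀ u) {H R A β t : ℝ} (hH : ∀ s, 0 ≤ s → ‖u s‖ ≤ H) (hR : 1 ≤ R)
    (hβ : β ≤ R ^ 2) (ht : 0 ≤ t)
    (hA : ∀ s ∈ Icc 0 t, √(∫ x, ‖highPass L hL (R * L / 2) (u s) x‖ ^ 2 ∂periodMeasure L) ≤
      A * Real.exp (β * (t - s))) {k : ℤ} (hk : R * L < |(k : ℝ)|) :
    ‖∫ x, ((u t x : ℝ) : ℂ) * mode L (-k) x ∂periodMeasure L‖ ^ 2 ≤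
      2 * Real.exp (-(2 * R ^ 2 * t)) *
        ‖∫ x, ((u 0 x : ℝ) : ℂ) * mode L (-k) x ∂periodMeasure L‖ ^ 2 +
      2 * (2 * H * A) ^ 2 / (Real.pi * k / L) ^ 6 := by
  set ξ := Real.pi * k / L with hξ
  have hH0 : 0 ≤ H := (norm_nonneg _).trans (hH 0 le_rfl)
  have hA0 : 0 ≤ A := by simpa using (Real.sqrt_nonneg _).trans (hA t ⟨ht, le_rfl⟩)
  have hξR : 3 * R ≤ |ξ| := by
    rw [hξ, abs_div, abs_mul, abs_of_pos Real.pi_pos, abs_of_pos hL, le_div_iff₀ hL, mul_assoc]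
    exact mul_le_mul Real.pi_gt_three.le hk.le (by positivity) Real.pi_pos.le
  have hξ0 : 0 < |ξ| := by linarith
  have hξ2 : 9 * R ^ 2 ≤ ξ ^ 2 := by
    rw [← sq_abs ξ]; nlinarith
  have hR2 : 1 ≤ R ^ 2 := one_le_pow₀ hR
  have hξ4 : 9 * ξ ^ 2 ≤ ξ ^ 4 := by nlinarith
  -- Both `ξ²` and `β` are at most `ξ⁴ / 9`, so half of the dissipation survives.
  have hgap : ξ ^ 4 / 2 ≤ ξ ^ 4 - ξ ^ 2 - β := by linarith
  have hgap0 : 0 < ξ ^ 4 / 2 := by nlinarith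
  have h := hu.norm_integral_mode_le hL (k := k) (T := t) (β := β) (B := |ξ| * H * A)
    (lam := ξ ^ 4 - ξ ^ 2) ht rfl (by linarith) (fun s hs => by
      have h1 := norm_integral_sq_mul_mode_le hL (N := R * L / 2) (k := k) (by linarith) (u s)
      calc _ ≤ |ξ| / 2 * (2 * H * (A * Real.exp (β * (t - s)))) := by
            gcongr
            refine h1.trans ?_
            gcongr
            · exact hH s hs.1
            · exact hA s hs
        _ = _ := by ring)
  set F0 := ‖∫ x, ((u 0 x : ℝ) : ℂ) * mode L (-k) x ∂periodMeasure L‖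
  have h1 : Real.exp (-((ξ ^ 4 - ξ ^ 2) * t)) ≤ Real.exp (-(R ^ 2 * t)) := by
    gcongr; linarith
  have h2 : |ξ| * H * A / (ξ ^ 4 - ξ ^ 2 - β) ≤ 2 * H * A / |ξ| ^ 3 := by
    calc _ ≤ |ξ| * H * A / (ξ ^ 4 / 2) := by gcongr
      _ = |ξ| * H * A / (|ξ| ^ 4 / 2) := by rw [Even.pow_abs (by decide)]
      _ = _ := by field_simp
  have h3 : (2 * H * A / |ξ| ^ 3) ^ 2 = (2 * H * A) ^ 2 / ξ ^ 6 := by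
    rw [div_pow, ← pow_mul, Even.pow_abs (by decide)]
  have h4 : Real.exp (-(R ^ 2 * t)) ^ 2 = Real.exp (-(2 * R ^ 2 * t)) := by
    rw [← Real.exp_nat_mul]; congr 1; push_cast; ring
  calc _ ≤ (Real.exp (-(R ^ 2 * t)) * F0 + 2 * H * A / |ξ| ^ 3) ^ 2 := by
        gcongr
        exact h.trans (add_le_add (by gcongr) h2)
    _ ≤ 2 * ((Real.exp (-(R ^ 2 * t)) * F0) ^ 2 + (2 * H * A / |ξ| ^ 3) ^ 2) := add_sq_le
    _ = _ := by rw [h3, mul_pow, h4]; ring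

/-- One step of the iteration, from cutoff `R * L / 2` to `R * L`. Bounding `k⁻⁶` by `(R * L)⁻⁴ k⁻²`
leaves a tail of order `1 / (R * L)`, hence the power `R⁵` after Parseval. -/
theorem IsSolution.integral_highPass_sq_le {L : ℝ} (hL : 0 < L) {u₀ : L2 L} {u : ℝ → L2 L}
    (hu : IsSolution L u₀ u) {H R A β t : ℝ} (hH : ∀ s, 0 ≤ s → ‖u s‖ ≤ H) (hR : 1 ≤ R)
    (hβ : β ≤ R ^ 2) (ht : 0 ≤ t)
    (hA : ∀ s ∈ Icc 0 t, √(∫ x, ‖highPass L hL (R * L / 2) (u s) x‖ ^ 2 ∂periodMeasure L) ≤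
      A * Real.exp (β * (t - s))) :
    ∫ x, ‖highPass L hL (R * L) (u t) x‖ ^ 2 ∂periodMeasure L ≤
      2 * Real.exp (-(2 * R ^ 2 * t)) * H ^ 2 + 2 * (H * A) ^ 2 / R ^ 5 := by
  have hR0 : 0 < R := by linarith
  have hH0 : 0 ≤ H := (norm_nonneg _).trans (hH 0 le_rfl)
  set E := 2 * Real.exp (-(2 * R ^ 2 * t)) with hE
  have hcoef : ∀ (f : L2 L) (k : ℤ),
      ‖fourierCoeffOn (neg_lt_self hL) (fun y => ((f y : ℝ) : ℂ)) k‖ ^ 2 =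
        ((2 * L) ^ 2)⁻¹ * ‖∫ x, ((f x : ℝ) : ℂ) * mode L (-k) x ∂periodMeasure L‖ ^ 2 := by
    intro f k
    rw [fourierCoeffOn_eq_integral_mode hL, norm_mul, norm_inv, Complex.norm_real, mul_pow,
      inv_pow, Real.norm_eq_abs, sq_abs]
  set D := 2 * (H * A) ^ 2 / (Real.pi ^ 6 * R ^ 4) with hD
  have hterm : ∀ k : ℤ, (if k ∈ Finset.Icc (-⌊R * L⌋) ⌊R * L⌋ then 0 else
        ‖fourierCoeffOn (neg_lt_self hL) (fun y => ((u t y : ℝ) : ℂ)) k‖ ^ 2) ≤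
      E * ‖fourierCoeffOn (neg_lt_self hL) (fun y => ((u 0 y : ℝ) : ℂ)) k‖ ^ 2 +
        D * (if R * L < |(k : ℝ)| then ((k : ℝ) ^ 2)⁻¹ else 0) := by
    intro k
    by_cases hk : R * L < |(k : ℝ)|
    · rw [if_neg (not_mem_Icc_floor_iff.2 hk), if_pos hk, hcoef, hcoef]
      have hk0 : 0 < |(k : ℝ)| := (by positivity : 0 < R * L).trans hk
      have hkne : (k : ℝ) ≠ 0 := abs_pos.1 hk0
      have hk4 : (R * L) ^ 4 ≤ (k : ℝ) ^ 4 := by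
        rw [← Even.pow_abs (n := 4) (by decide) (k : ℝ)]
        gcongr
      have e := hu.sq_norm_integral_mode_le hL hH hR hβ ht hA hk
      calc _ ≤ ((2 * L) ^ 2)⁻¹ * _ := mul_le_mul_of_nonneg_left e (by positivity)
        _ = E * (((2 * L) ^ 2)⁻¹ *
              ‖∫ x, ((u 0 x : ℝ) : ℂ) * mode L (-k) x ∂periodMeasure L‖ ^ 2) +
            2 * (H * A) ^ 2 * L ^ 4 / (Real.pi ^ 6 * ((k : ℝ) ^ 4 * (k : ℝ) ^ 2)) := by
              rw [hE, div_pow, mul_pow Real.pi]; field_simp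
        _ ≤ E * (((2 * L) ^ 2)⁻¹ *
              ‖∫ x, ((u 0 x : ℝ) : ℂ) * mode L (-k) x ∂periodMeasure L‖ ^ 2) +
            2 * (H * A) ^ 2 * L ^ 4 / (Real.pi ^ 6 * ((R * L) ^ 4 * (k : ℝ) ^ 2)) := by
              gcongr
        _ = _ := by rw [hD]; field_simp
    · rw [if_pos (not_not.1 (not_mem_Icc_floor_iff.not.2 hk)), if_neg hk]
      positivity
  have hsum : ∀ s : Finset ℤ, ∑ k ∈ s, (if k ∈ Finset.Icc (-⌊R * L⌋) ⌊R * L⌋ then 0 else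
        ‖fourierCoeffOn (neg_lt_self hL) (fun y => ((u t y : ℝ) : ℂ)) k‖ ^ 2) ≤
      E * ((2 * L)⁻¹ * H ^ 2) + D * (4 / (R * L)) := by
    intro s
    refine (Finset.sum_le_sum fun k _ => hterm k).trans ?_
    rw [Finset.sum_add_distrib, ← Finset.mul_sum, ← Finset.mul_sum, ← Finset.sum_filter]
    gcongr
    · refine (sum_le_hasSum s (fun _ _ => by positivity) (hasSum_coeff hL (u 0))).trans ?_
      gcongr
      exact hH 0 le_rfl
    · exact sum_inv_sq_le (by positivity) _ fun k hk => (Finset.mem_filter.1 hk).2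
  have hfin := hasSum_le_of_sum_le (hasSum_highPass hL (R * L) (u t)) hsum
  rw [inv_mul_le_iff₀ (by positivity)] at hfin
  refine hfin.trans ?_
  have hpi : 8 ≤ Real.pi ^ 6 := by
    calc (8 : ℝ) ≤ 3 ^ 6 := by norm_num
      _ ≤ _ := by gcongr; exact Real.pi_gt_three.le
  calc _ = E * H ^ 2 + 2 * (H * A) ^ 2 / R ^ 5 * (8 / Real.pi ^ 6) := by
        rw [hD]; field_simp; ring
    _ ≤ E * H ^ 2 + 2 * (H * A) ^ 2 / R ^ 5 * 1 := by
        gcongr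
        exact (div_le_one (by positivity)).2 hpi
    _ = _ := by rw [mul_one]

/-! ### Induction on the dyadic scale. -/

theorem IsSolution.sqrt_integral_highPass_sq_le {L : ℝ} (hL : 0 < L) {u₀ : L2 L} {u : ℝ → L2 L}
    (hu : IsSolution L u₀ u) {H : ℝ} (hH : ∀ s, 0 ≤ s → ‖u s‖ ≤ H) (j : ℕ) {t : ℝ} (ht : 0 ≤ t) :
    √(∫ x, ‖highPass L hL (2 ^ j * max 1 H ^ (2 / 5 : ℝ) * L) (u t) x‖ ^ 2 ∂periodMeasure L) ≤
      2 ^ j * Real.exp (-(Real.log 2 / 2 * min t (5 / 2) * (j : ℝ) ^ 2)) * H := by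
  have hH0 : 0 ≤ H := (norm_nonneg _).trans (hH 0 le_rfl)
  set M := max 1 H ^ (2 / 5 : ℝ) with hM
  have hM1 : 1 ≤ M := Real.one_le_rpow (le_max_left _ _) (by norm_num)
  -- The exponent `2/5` is chosen so that `M ^ 5` absorbs the `H²` produced by the nonlinearity.
  have hM5 : H ^ 2 ≤ M ^ 5 := by
    rw [hM, ← Real.rpow_natCast (_ ^ _) 5, ← Real.rpow_mul (by positivity)]
    norm_num
    gcongr
    exact le_max_right _ _
  have hl0 : 0 < Real.log 2 := Real.log_pos one_lt_two
  have hl1 : Real.log 2 ≤ 1 := by have := Real.log_two_lt_d9; linarith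
  induction j generalizing t with
  | zero =>
    simp only [pow_zero, one_mul, Nat.cast_zero, ne_eq, OfNat.ofNat_ne_zero, not_false_eq_true,
      zero_pow, mul_zero, neg_zero, Real.exp_zero]
    refine Real.sqrt_le_left hH0 |>.2 ((integral_norm_highPass_sq_le hL _ (u t)).trans ?_)
    gcongr
    exact hH t ht
  | succ j ih =>
    set R := 2 ^ (j + 1) * M with hR
    set τ := min t (5 / 2) with hτ
    have hτ0 : 0 ≤ τ := le_min ht (by norm_num)
    have hτt : τ ≤ t := min_le_left _ _
    have hτ5 : τ ≤ 5 / 2 := min_le_right _ _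
    have h2R : (2 : ℝ) ^ (j + 1) ≤ R := le_mul_of_one_le_right (by positivity) hM1
    have hR1 : 1 ≤ R := (one_le_pow₀ one_le_two).trans h2R
    have hjR : (j : ℝ) + 1 ≤ R := by
      have : ((j + 1 : ℕ) : ℝ) < 2 ^ (j + 1) := by exact_mod_cast Nat.lt_two_pow_self
      push_cast at this
      linarith
    have hjR2 : ((j : ℝ) + 1) ^ 2 ≤ R ^ 2 := by gcongr
    set A := 2 ^ j * Real.exp (-(Real.log 2 / 2 * τ * (j : ℝ) ^ 2)) * H with hA
    have key := hu.integral_highPass_sq_le hL (A := A) (β := Real.log 2 / 2 * (j : ℝ) ^ 2) hH hR1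
      (by nlinarith [sq_nonneg (j : ℝ)]) ht (fun s hs => by
        have e1 := ih hs.1
        rw [show R * L / 2 = 2 ^ j * M * L by rw [hR]; ring]
        refine e1.trans ?_
        rw [hA, mul_right_comm _ H, mul_assoc (2 ^ j) _ (Real.exp _), ← Real.exp_add]
        gcongr
        -- Truncation at `5/2` is 1-Lipschitz, so the bound at an earlier time `s` exceeds the one
        -- at `t` by at most `e^{β(t-s)}`, which is the form of forcing that Duhamel's estimate
        -- accepts.
        have e2 : τ - min s (5 / 2) ≤ t - s := by
          have := hs.2
          rcases le_total s (5 / 2) with h | h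
          · rw [min_eq_left h]; linarith
          · rw [min_eq_right h]; linarith
        have e3 := mul_le_mul_of_nonneg_left e2
          (by positivity : 0 ≤ Real.log 2 / 2 * (j : ℝ) ^ 2)
        linarith)
    set W := Real.exp (-(Real.log 2 * τ * ((j : ℝ) + 1) ^ 2)) with hW
    have hW2 : Real.exp (-(Real.log 2 / 2 * τ * ((j : ℝ) + 1) ^ 2)) ^ 2 = W := by
      rw [← Real.exp_nat_mul]; congr 1; push_cast; ring
    have hlin : Real.exp (-(2 * R ^ 2 * t)) ≤ W := by
      rw [hW]
      refine Real.exp_le_exp.2 (neg_le_neg ?_)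
      calc Real.log 2 * τ * ((j : ℝ) + 1) ^ 2 ≤ 1 * t * R ^ 2 := by gcongr
        _ ≤ _ := by nlinarith [mul_nonneg ht (sq_nonneg R)]
    have hnl : (H * A) ^ 2 / R ^ 5 ≤ 4 ^ j * W * H ^ 2 := by
      have hA2 : A ^ 2 = 4 ^ j * Real.exp (-(Real.log 2 * τ * (j : ℝ) ^ 2)) * H ^ 2 := by
        rw [hA, mul_pow, mul_pow, ← Real.exp_nat_mul, ← pow_mul, mul_comm j, pow_mul]
        congr 3
        · norm_num
        · push_cast; ring
      have hp : Real.exp (-(Real.log 2 * τ * (j : ℝ) ^ 2)) ≤ (2 ^ (j + 1)) ^ 5 * W := by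
        have : (2 : ℝ) ^ (j + 1) = Real.exp (Real.log 2 * ((j : ℝ) + 1)) := by
          rw [← Real.rpow_natCast, Real.rpow_def_of_pos two_pos]; push_cast; rfl
        rw [this, ← Real.exp_nat_mul, hW, ← Real.exp_add]
        refine Real.exp_le_exp.2 ?_
        -- The threshold `5/2` enters here: `τ(2j+1) ≤ 5(j+1)`, with surplus `(5/2 - τ)(2j+1) +
        -- 5/2`.
        have e4 : 0 ≤ Real.log 2 * ((5 / 2 - τ) * (2 * j + 1) + 5 / 2) := by
          have : 0 ≤ 5 / 2 - τ := by linarith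
          positivity
        push_cast
        linarith
      rw [div_le_iff₀ (by positivity), mul_pow H, hA2, hR, mul_pow]
      calc _ = 4 ^ j * H ^ 2 * (H ^ 2 * Real.exp (-(Real.log 2 * τ * (j : ℝ) ^ 2))) := by ring
        _ ≤ 4 ^ j * H ^ 2 * (M ^ 5 * ((2 ^ (j + 1)) ^ 5 * W)) := by gcongr
        _ = _ := by ring
    refine Real.sqrt_le_left (by positivity) |>.2 (key.trans ?_)
    push_cast
    rw [mul_pow _ H, mul_pow _ (Real.exp _), hW2, ← pow_mul, mul_comm (j + 1), pow_mul]
    have h4 : (1 : ℝ) ≤ 4 ^ j := one_le_pow₀ (by norm_num)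
    have hWH : 0 ≤ W * H ^ 2 := by positivity
    calc 2 * Real.exp (-(2 * R ^ 2 * t)) * H ^ 2 + 2 * (H * A) ^ 2 / R ^ 5
        = 2 * Real.exp (-(2 * R ^ 2 * t)) * H ^ 2 + 2 * ((H * A) ^ 2 / R ^ 5) := by ring
      _ ≤ 2 * W * H ^ 2 + 2 * (4 ^ j * W * H ^ 2) := by gcongr
      _ = (2 + 2 * 4 ^ j) * (W * H ^ 2) := by ring
      -- The linear and nonlinear contributions together cost a factor 4 in the square, hence `C₁ =
      -- 2`.
      _ ≤ (4 * 4 ^ j) * (W * H ^ 2) := by gcongr; linarith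
      _ = _ := by rw [pow_succ]; ring

end KuramotoSivashinsky

end

theorem mainTheorem1 :
    ∃ C₀ C₁ : ℝ, 0 < C₀ ∧ 0 < C₁ ∧
      ∀ (L : ℝ) (hL : 1 ≤ L) (u₀ : KuramotoSivashinsky.L2 L) (u : ℝ → KuramotoSivashinsky.L2 L),
        KuramotoSivashinsky.IsSolution L u₀ u →
        ∀ H : ℝ, IsLUB ((fun s : ℝ => ‖u s‖) '' Ici 0) H →
        ∀ (j : ℕ) (t : ℝ), 0 ≤ t →
          eLpNorm
              (KuramotoSivashinsky.highPass L (zero_lt_one.trans_le hL)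
                (C₀ * 2 ^ j * (max 1 H) ^ (2 / 5 : ℝ) * L) (u t))
              2 (KuramotoSivashinsky.periodMeasure L)
            ≤ ENNReal.ofReal
                (C₁ ^ j * (2 : ℝ) ^ (-(1 / 2) * min t (5 / 2) * (j : ℝ) ^ 2) * H) := by
  refine ⟨1, 2, one_pos, two_pos, fun L hL u₀ u hu H hH j t ht => ?_⟩
  rw [KuramotoSivashinsky.eLpNorm_two_eq_ofReal_sqrt
    (KuramotoSivashinsky.memLp_highPass _ _ (u t))]
  refine ENNReal.ofReal_le_ofReal ?_
  have h := hu.sqrt_integral_highPass_sq_le (zero_lt_one.trans_le hL)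
    (fun s hs => hH.1 ⟨s, hs, rfl⟩) j ht
  rw [one_mul, Real.rpow_def_of_pos two_pos]
  convert h using 4
  ring
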